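/- Write $\mathbb N=\{0,1,2,\dots\}$, let $\le$ be the componentwise order on $\mathbb Z^2$ and $\boldsymbol\alpha\wedge\boldsymbol\beta$ the componentwise minimum. A submonoid $S$ of $(\mathbb N^2,+)$ is called a (local) good semigroup if (G1) $\boldsymbol\alpha\wedge\boldsymbol\beta\in S$ for all $\boldsymbol\alpha,\boldsymbol\beta\in S$; (G2) if $\boldsymbol\alpha,\boldsymbol\beta\in S$, $\{i,j\}=\{1,2\}$ and $\alpha_i=\beta_i$, then there is $\boldsymbol\delta\in S$ with $\delta_i>\alpha_i=\beta_i$, $\delta_j\ge\min\{\alpha_j,\beta_j\}$, and $\delta_j=\min\{\alpha_j,\beta_j\}$ if $\alpha_j\neq\beta_j$; (G3) there is $\boldsymbol c\in S$ with $\boldsymbol c+\mathbb N^2\subseteq S$; and $S$ is local: $\boldsymbol 0$ is the only element of $S$ with a zero component. Let $S$ be such a semigroup. Let $\boldsymbol c$ be its conductor, that is, the least $\boldsymbol c$ with $\boldsymbol c+\mathbb N^2\subseteq S$, put $\boldsymbol\gamma=\boldsymbol c-(1,1)$, let $\boldsymbol e=(e_1,e_2)$ be the least nonzero element of $S$, and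 put $e=e_1+e_2$. For $\boldsymbol\alpha\in\mathbb Z^2$ let $$\Delta^S(\boldsymbol\alpha)=\{\boldsymbol\beta\in S:\ (\beta_1=\alpha_1\text{ and }\beta_2>\alpha_2)\ \text{or}\ (\beta_2=\alpha_2\text{ and }\beta_1>\alpha_1)\}.$$ $S$ is symmetric if, for every $\boldsymbol\alpha\in\mathbb N^2$, one has $\boldsymbol\alpha\in S$ if and only if $\Delta^S(\boldsymbol\gamma-\boldsymbol\alpha)=\emptyset$. The Apéry set of $S$ is $\mathbf{Ap}(S)=\{\boldsymbol\alpha\in S:\boldsymbol\alpha-\boldsymbol e\notin S\}$. Its levels are defined as follows. Write $\boldsymbol\alpha\ll\boldsymbol\beta$ if $\alpha_1<\beta_1$ and $\alpha_2<\beta_2$, and $\boldsymbol\alpha\le\le\boldsymbol\beta$ if $\boldsymbol\alpha=\boldsymbol\beta$ or $\boldsymbol\alpha\ll\boldsymbol\beta$. For $i=1,2,\dots$ define recursively $$B^{(i)}=\Big\{\boldsymbol\alpha:\ \boldsymbol\alpha\text{ is maximal with respect to }\le\le\text{ in }\mathbf{Ap}(S)\setminus\bigcup_{j<i}D^{(j)}\Big\},$$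 $$C^{(i)}=\{\boldsymbol\alpha\in B^{(i)}:\ \boldsymbol\alpha=\boldsymbol\beta_1\wedge\boldsymbol\beta_2\text{ for some }\boldsymbol\beta_1,\boldsymbol\beta_2\in B^{(i)}\setminus\{\boldsymbol\alpha\}\},\qquad D^{(i)}=B^{(i)}\setminus C^{(i)}.$$ Let $N$ be the least integer with $\mathbf{Ap}(S)=\bigcup_{i=1}^N D^{(i)}$, and let the levels be $A_i=D^{(N+1-i)}$ for $1\le i\le N$, with $A_i=\emptyset$ for all other $i$. (It is known that $N=e_1+e_2=e$.) For $\boldsymbol\omega\in\mathbb N^2$ put $\boldsymbol\omega'=\boldsymbol\gamma+\boldsymbol e-\boldsymbol\omega\in\mathbb Z^2$, and for $1\le i\le e$ put $$A_i'=\Big(\bigcup_{\boldsymbol\omega\in A_i}\Delta^S(\boldsymbol\omega')\Big)\setminus\Big(\bigcup_{j<i}\ \bigcup_{\boldsymbol\omega\in A_j}\Delta^S(\boldsymbol\omega')\Big).$$ Theorem (label duality). The following are equivalent: 1. $S$ is symmetric; 2. $A_i'=A_{e-i+1}$ for every $i=1,\dots,e$. -/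

import Mathlib

namespace GoodSemigroup

/-- A local good subsemigroup of `ℕ²`; the order and the meet `⊓` on `ℕ × ℕ` are componentwise. -/
structure IsGood (S : AddSubmonoid (ℕ × ℕ)) : Prop where
  /-- (G1) -/
  inf_mem : ∀ α ∈ S, ∀ β ∈ S, α ⊓ β ∈ S
  /-- (G2) for the first component -/
  exists_fst : ∀ α ∈ S, ∀ β ∈ S, α.1 = β.1 →
    ∃ δ ∈ S, α.1 < δ.1 ∧ min α.2 β.2 ≤ δ.2 ∧ (α.2 ≠ β.2 → δ.2 = min α.2 β.2)
  /-- (G2) for the second component -/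
  exists_snd : ∀ α ∈ S, ∀ β ∈ S, α.2 = β.2 →
    ∃ δ ∈ S, α.2 < δ.2 ∧ min α.1 β.1 ≤ δ.1 ∧ (α.1 ≠ β.1 → δ.1 = min α.1 β.1)
  /-- (G3) -/
  exists_cond : ∃ c ∈ S, ∀ β : ℕ × ℕ, c + β ∈ S
  /-- `S` is local -/
  isLocal : ∀ α ∈ S, α.1 = 0 ∨ α.2 = 0 → α = 0

/-- The set of all `α` with `α + ℕ² ⊆ S`. -/
def condSet (S : AddSubmonoid (ℕ × ℕ)) : Set (ℕ × ℕ) := {α | ∀ β : ℕ × ℕ, α + β ∈ S}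

/-- The conductor `c` of `S`. The infimum in `ℕ × ℕ` is componentwise; for a good semigroup it is
the minimum of `condSet S`, see `IsGood.isLeast_conductor`. -/
noncomputable def conductor (S : AddSubmonoid (ℕ × ℕ)) : ℕ × ℕ := sInf (condSet S)

/-- `γ = c - (1, 1)`, computed in `ℤ²`. -/
noncomputable def gam (S : AddSubmonoid (ℕ × ℕ)) : ℤ × ℤ :=
  (((conductor S).1 : ℤ) - 1, ((conductor S).2 : ℤ) - 1)

/-- The smallest nonzero element `e = (e₁, e₂)` of `S`. For a good semigroup it is the minimum of
`S \ {0}`, see `IsGood.isLeast_minElt`. -/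
noncomputable def minElt (S : AddSubmonoid (ℕ × ℕ)) : ℕ × ℕ := sInf {α | α ∈ S ∧ α ≠ 0}

/-- The inclusion of `ℕ²` in `ℤ²`. -/
def toZ (α : ℕ × ℕ) : ℤ × ℤ := ((α.1 : ℤ), (α.2 : ℤ))

/-- `Δ₁(α)`: the points of `ℤ²` strictly above `α` on the same vertical line. -/
def Delta₁ (α : ℤ × ℤ) : Set (ℤ × ℤ) := {β | α.1 = β.1 ∧ α.2 < β.2}

/-- `Δ₂(α)`: the points of `ℤ²` strictly to the right of `α` on the same horizontal line. -/
def Delta₂ (α : ℤ × ℤ) : Set (ℤ × ℤ) := {β | α.2 = β.2 ∧ α.1 < β.1}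

/-- `Δ(α) = Δ₁(α) ∪ Δ₂(α)`. -/
def Delta (α : ℤ × ℤ) : Set (ℤ × ℤ) := Delta₁ α ∪ Delta₂ α

/-- `Δ^S(α) = Δ(α) ∩ S`. -/
def DeltaS (S : AddSubmonoid (ℕ × ℕ)) (α : ℤ × ℤ) : Set (ℕ × ℕ) := {β | β ∈ S ∧ toZ β ∈ Delta α}

/-- `S` is symmetric. -/
def IsSymmetric (S : AddSubmonoid (ℕ × ℕ)) : Prop :=
  ∀ α : ℕ × ℕ, α ∈ S ↔ DeltaS S (gam S - toZ α) = ∅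

/-- The Apéry set of `S` with respect to `β`: the `α ∈ S` with `α - β ∉ S`. -/
def Apery (S : AddSubmonoid (ℕ × ℕ)) (β : ℕ × ℕ) : Set (ℕ × ℕ) :=
  {α | α ∈ S ∧ ¬ ∃ σ ∈ S, σ + β = α}

/-- `Ap(S)`, the Apéry set with respect to the smallest nonzero element. -/
def Ap (S : AddSubmonoid (ℕ × ℕ)) : Set (ℕ × ℕ) := Apery S (minElt S)

/-- `α ≪ β`. -/
def StrictDom (α β : ℕ × ℕ) : Prop := α.1 < β.1 ∧ α.2 < β.2

/-- `α ≤≤ β`: equal, or strictly smaller in both components. -/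
def Dom (α β : ℕ × ℕ) : Prop := α = β ∨ StrictDom α β

/-- The elements of `X` that are maximal in `X` with respect to `≤≤`. -/
def maxB (X : Set (ℕ × ℕ)) : Set (ℕ × ℕ) := {α | α ∈ X ∧ ∀ β ∈ X, Dom α β → α = β}

/-- The maximal elements that are the meet of two other maximal elements. -/
def infC (X : Set (ℕ × ℕ)) : Set (ℕ × ℕ) :=
  {α | α ∈ maxB X ∧ ∃ β₁ ∈ maxB X \ {α}, ∃ β₂ ∈ maxB X \ {α}, α = β₁ ⊓ β₂}

/-- One step of the construction of the levels. -/
def layer (X : Set (ℕ × ℕ)) : Set (ℕ × ℕ) := maxB X \ infC X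

/-- What is left of `Ap(S)` after the removal of `D⁽¹⁾, …, D⁽ᵏ⁾`. -/
def remaining (S : AddSubmonoid (ℕ × ℕ)) : ℕ → Set (ℕ × ℕ)
  | 0 => Ap S
  | k + 1 => remaining S k \ layer (remaining S k)

/-- `apLayer S k` is the set `D⁽ᵏ⁺¹⁾` (the sets `D⁽ⁱ⁾` are numbered from `1`). -/
def apLayer (S : AddSubmonoid (ℕ × ℕ)) (k : ℕ) : Set (ℕ × ℕ) := layer (remaining S k)

/-- The number `N` of levels: the least `N` such that `Ap(S) = D⁽¹⁾ ∪ … ∪ D⁽ᴺ⁾`. -/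
noncomputable def numLevels (S : AddSubmonoid (ℕ × ℕ)) : ℕ :=
  sInf {N : ℕ | Ap S = ⋃ k < N, apLayer S k}

/-- The level `Aᵢ = D⁽ᴺ⁺¹⁻ⁱ⁾` for `1 ≤ i ≤ N`; empty for all other `i`. -/
def level (S : AddSubmonoid (ℕ × ℕ)) (i : ℕ) : Set (ℕ × ℕ) :=
  {α | 1 ≤ i ∧ i ≤ numLevels S ∧ α ∈ apLayer S (numLevels S - i)}

/-- `α' = γ + e - α`, in `ℤ²`. -/
noncomputable def dual (S : AddSubmonoid (ℕ × ℕ)) (α : ℕ × ℕ) : ℤ × ℤ :=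
  gam S + toZ (minElt S) - toZ α

/-- `Aᵢ'`: the union of the `Δ^S(ω')` with `ω ∈ Aᵢ`, minus the union of those with `ω ∈ Aⱼ`,
`j < i`. -/
def dualLevel (S : AddSubmonoid (ℕ × ℕ)) (i : ℕ) : Set (ℕ × ℕ) :=
  (⋃ ω ∈ level S i, DeltaS S (dual S ω)) \ ⋃ j < i, ⋃ ω ∈ level S j, DeltaS S (dual S ω)

/-- The integer `e = e₁ + e₂`. -/
noncomputable def mult (S : AddSubmonoid (ℕ × ℕ)) : ℕ := (minElt S).1 + (minElt S).2

theorem isLeast_sInf_of_inf {X : Set (ℕ × ℕ)} (hne : X.Nonempty)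
    (hinf : ∀ α ∈ X, ∀ β ∈ X, α ⊓ β ∈ X) : IsLeast X (sInf X) := by
  obtain ⟨a, ha, ha'⟩ := Nat.sInf_mem (hne.image Prod.fst)
  obtain ⟨b, hb, hb'⟩ := Nat.sInf_mem (hne.image Prod.snd)
  have h1 : ∀ x ∈ X, sInf (Prod.fst '' X) ≤ x.1 := fun x hx => Nat.sInf_le ⟨x, hx, rfl⟩
  have h2 : ∀ x ∈ X, sInf (Prod.snd '' X) ≤ x.2 := fun x hx => Nat.sInf_le ⟨x, hx, rfl⟩
  have h : sInf X = a ⊓ b := by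
    refine Prod.ext ?_ ?_
    · change sInf (Prod.fst '' X) = min a.1 b.1
      have := h1 b hb
      omega
    · change sInf (Prod.snd '' X) = min a.2 b.2
      have := h2 a ha
      omega
  refine ⟨h ▸ hinf a ha b hb, fun x hx => ⟨h1 x hx, h2 x hx⟩⟩

theorem mem_condSet_iff {S : AddSubmonoid (ℕ × ℕ)} {α : ℕ × ℕ} :
    α ∈ condSet S ↔ ∀ β, α ≤ β → β ∈ S := by
  constructor
  · intro h β hβ
    have := h (β - α)
    rwa [add_tsub_cancel_of_le hβ] at this
  · intro h β
    exact h _ le_self_add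

theorem IsGood.isLeast_conductor {S : AddSubmonoid (ℕ × ℕ)} (hS : IsGood S) :
    IsLeast (condSet S) (conductor S) := by
  refine isLeast_sInf_of_inf ?_ ?_
  · obtain ⟨c, -, hc⟩ := hS.exists_cond
    exact ⟨c, hc⟩
  · intro α hα β hβ
    rw [mem_condSet_iff] at *
    intro x hx
    have h : x = (α ⊔ x) ⊓ (β ⊔ x) := by rw [← sup_inf_right, sup_eq_right.2 hx]
    rw [h]
    exact hS.inf_mem _ (hα _ le_sup_left) _ (hβ _ le_sup_left)

theorem IsGood.isLeast_minElt {S : AddSubmonoid (ℕ × ℕ)} (hS : IsGood S) :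
    IsLeast {α | α ∈ S ∧ α ≠ 0} (minElt S) := by
  refine isLeast_sInf_of_inf ?_ ?_
  · obtain ⟨c, -, hc⟩ := hS.exists_cond
    refine ⟨c + (1, 1), hc _, fun h => ?_⟩
    have := congrArg Prod.fst h
    simp at this
  · rintro α ⟨hα, hα0⟩ β ⟨hβ, hβ0⟩
    refine ⟨hS.inf_mem _ hα _ hβ, fun h => ?_⟩
    have ha : ¬ (α.1 = 0 ∨ α.2 = 0) := fun h => hα0 (hS.isLocal α hα h)
    have hb : ¬ (β.1 = 0 ∨ β.2 = 0) := fun h => hβ0 (hS.isLocal β hβ h)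
    have h' : min α.1 β.1 = 0 := congrArg Prod.fst h
    omega

/-- The recursion removes exactly the sets constructed so far. -/
theorem remaining_eq (S : AddSubmonoid (ℕ × ℕ)) (k : ℕ) :
    remaining S k = Ap S \ ⋃ j < k, apLayer S j := by
  induction k with
  | zero => simp [remaining]
  | succ k ih =>
    have h : (⋃ j < k + 1, apLayer S j) = (⋃ j < k, apLayer S j) ∪ apLayer S k :=
      Set.biUnion_lt_succ _ _
    rw [h, ← Set.sdiff_sdiff, ← ih]
    rfl

end GoodSemigroup

/-! ### Counting columns and rows along lattice paths -/

namespace GoodSemigroup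

/-! Let `g` (`IsGood.value`) count, along a lattice path from the origin, the columns and rows met
by `S` ahead of the path minus those met by `e + S`. By (G2) the count does not depend on the path;
`g` is monotone, unit steps raise it by at most one, and its maximum is `e₁ + e₂`. The levels of the
Apéry set are the fibres of `g` (`IsGoodPair.layer_sublevel`, `IsGood.mem_level_iff`).

If `S` is symmetric, a column meets `S` above a point exactly when the opposite column misses `e +
S` above the opposite point, whence `g P + g (c + e - P) = e₁ + e₂` (`IsGoodPair.add_dual`). Hence
`g ω + g β + 1` is at least `e₁ + e₂` whenever `β` lies in `Δ^S(ω')`, and each Apéry element `β`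
admits an Apéry element `ω` attaining equality. So the first `i` whose dual sets reach `β` is
determined by `g β`, which is the label duality.

Conversely, the label duality places every Apéry element in some `Δ^S(ω')`, and subtracting
multiples of `e` turns this into symmetry (`IsGood.isSymmetric_of_forall_dual`). -/

open Classical in
/-- The indicator of a proposition. -/
noncomputable def ind (p : Prop) : ℤ := if p then 1 else 0

theorem ind_true {p : Prop} (h : p) : ind p = 1 := if_pos h

theorem ind_false {p : Prop} (h : ¬ p) : ind p = 0 := if_neg h

/-- `X` has a point on the column `x` at height at least `y`. -/
def UpFst (X : Set (ℕ × ℕ)) (x y : ℕ) : Prop := ∃ b, y ≤ b ∧ (x, b) ∈ X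

/-- `X` has a point on the row `y` at abscissa at least `x`. -/
def UpSnd (X : Set (ℕ × ℕ)) (x y : ℕ) : Prop := ∃ a, x ≤ a ∧ (a, y) ∈ X

/-- Above a point of `X` there is another one if and only if there is one to its right. -/
def IsBalanced (X : Set (ℕ × ℕ)) : Prop :=
  ∀ x y, (x, y) ∈ X → (UpFst X x (y + 1) ↔ UpSnd X (x + 1) y)

/-- The number of columns and rows of `X` met by a path from the origin to `(x, y)`. -/
noncomputable def count (X : Set (ℕ × ℕ)) (x y : ℕ) : ℤ :=
  ∑ i ∈ Finset.range x, ind (UpFst X i 0) + ∑ j ∈ Finset.range y, ind (UpSnd X x j)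

theorem upFst_iff {X : Set (ℕ × ℕ)} {x y : ℕ} :
    UpFst X x y ↔ (x, y) ∈ X ∨ UpFst X x (y + 1) := by
  constructor
  · rintro ⟨b, hb, h⟩
    rcases hb.eq_or_lt with rfl | hb
    · exact .inl h
    · exact .inr ⟨b, hb, h⟩
  · rintro (h | ⟨b, hb, h⟩)
    · exact ⟨y, le_rfl, h⟩
    · exact ⟨b, by omega, h⟩

theorem upSnd_iff {X : Set (ℕ × ℕ)} {x y : ℕ} :
    UpSnd X x y ↔ (x, y) ∈ X ∨ UpSnd X (x + 1) y := by
  constructor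
  · rintro ⟨b, hb, h⟩
    rcases hb.eq_or_lt with rfl | hb
    · exact .inl h
    · exact .inr ⟨b, hb, h⟩
  · rintro (h | ⟨b, hb, h⟩)
    · exact ⟨x, le_rfl, h⟩
    · exact ⟨b, by omega, h⟩

theorem count_succ_snd (X : Set (ℕ × ℕ)) (x y : ℕ) :
    count X x (y + 1) = count X x y + ind (UpSnd X x y) := by
  simp only [count, Finset.sum_range_succ]
  ring

/-- Path independence around a unit square. If its lower left corner is in `X`, both edges leaving
that corner count and balancedness equates the other two; if not, opposite edges count equally. -/
theorem count_succ_fst {X : Set (ℕ × ℕ)} (hX : IsBalanced X) (x y : ℕ) :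
    count X (x + 1) y = count X x y + ind (UpFst X x y) := by
  induction y with
  | zero => simp [count, Finset.sum_range_succ]
  | succ y ih =>
    rw [count_succ_snd, ih, count_succ_snd, upFst_iff (y := y), upSnd_iff (x := x) (y := y)]
    by_cases h : (x, y) ∈ X
    · simp only [h, true_or, hX x y h]
    · simp only [h, false_or]
      ring

/-! ### Pairs `Y ⊆ X` and their value function -/

/-- A balanced, meet-closed set `X`, a subset `Y` of the same kind that contains every point above
`C`, and a function `g` on the grid which counts the columns and rows of `X` not met by `Y`. -/
structure IsGoodPair (X Y : Set (ℕ × ℕ)) (C : ℕ × ℕ) (g : ℕ → ℕ → ℤ) : Prop where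
  subset : Y ⊆ X
  inf_left : ∀ α ∈ X, ∀ β ∈ X, α ⊓ β ∈ X
  inf_right : ∀ α ∈ Y, ∀ β ∈ Y, α ⊓ β ∈ Y
  balanced : IsBalanced X
  full : ∀ x y, C.1 ≤ x → C.2 ≤ y → (x, y) ∈ Y
  zero : g 0 0 = 0
  succ_fst : ∀ x y, g (x + 1) y = g x y + ind (UpFst X x y) - ind (UpFst Y x y)
  succ_snd : ∀ x y, g x (y + 1) = g x y + ind (UpSnd X x y) - ind (UpSnd Y x y)

namespace IsGoodPair

variable {X Y : Set (ℕ × ℕ)} {C : ℕ × ℕ} {g : ℕ → ℕ → ℤ}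

theorem swap (h : IsGoodPair X Y C g) :
    IsGoodPair (Prod.swap ⁻¹' X) (Prod.swap ⁻¹' Y) C.swap (fun x y => g y x) where
  subset := fun _ ha => h.subset ha
  inf_left := fun _ ha _ hb => h.inf_left _ ha _ hb
  inf_right := fun _ ha _ hb => h.inf_right _ ha _ hb
  balanced := fun x y hxy => (h.balanced y x hxy).symm
  full := fun x y hx hy => h.full y x hy hx
  zero := h.zero
  succ_fst := fun x y => h.succ_snd y x
  succ_snd := fun x y => h.succ_fst y x

theorem upFst_mono (h : IsGoodPair X Y C g) {x y : ℕ} (hY : UpFst Y x y) : UpFst X x y :=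
  let ⟨b, hb, hm⟩ := hY; ⟨b, hb, h.subset hm⟩

theorem succ_fst_eq_of_not (h : IsGoodPair X Y C g) {x y : ℕ} (hX : ¬ UpFst X x y) :
    g (x + 1) y = g x y := by
  rw [h.succ_fst, ind_false hX, ind_false fun hY => hX (h.upFst_mono hY)]
  ring

theorem succ_fst_eq_of_mem (h : IsGoodPair X Y C g) {x y : ℕ} (hY : UpFst Y x y) :
    g (x + 1) y = g x y := by
  rw [h.succ_fst, ind_true hY, ind_true (h.upFst_mono hY)]
  ring

theorem succ_fst_eq_add_one (h : IsGoodPair X Y C g) {x y : ℕ} (hX : UpFst X x y)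
    (hY : ¬ UpFst Y x y) : g (x + 1) y = g x y + 1 := by
  rw [h.succ_fst, ind_true hX, ind_false hY]
  ring

theorem succ_fst_cases (h : IsGoodPair X Y C g) (x y : ℕ) :
    g (x + 1) y = g x y ∨ (g (x + 1) y = g x y + 1 ∧ UpFst X x y ∧ ¬ UpFst Y x y) := by
  by_cases hX : UpFst X x y
  · by_cases hY : UpFst Y x y
    · exact .inl (h.succ_fst_eq_of_mem hY)
    · exact .inr ⟨h.succ_fst_eq_add_one hX hY, hX, hY⟩
  · exact .inl (h.succ_fst_eq_of_not hX)

theorem mono_fst (h : IsGoodPair X Y C g) (y : ℕ) : Monotone fun x => g x y :=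
  monotone_nat_of_le_succ fun x => by rcases h.succ_fst_cases x y with h | h <;> omega

theorem mono (h : IsGoodPair X Y C g) {x y x' y' : ℕ} (hx : x ≤ x') (hy : y ≤ y') :
    g x y ≤ g x' y' :=
  (h.mono_fst y hx).trans (h.swap.mono_fst x' hy)

theorem eq_of_ge_fst (h : IsGoodPair X Y C g) {x : ℕ} (y : ℕ) (hx : C.1 ≤ x) :
    g x y = g C.1 y := by
  induction x, hx using Nat.le_induction with
  | base => rfl
  | succ x hx ih =>
    rw [h.succ_fst_eq_of_mem ⟨max y C.2, le_max_left _ _, h.full _ _ hx (le_max_right _ _)⟩, ih]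

theorem eq_min_fst (h : IsGoodPair X Y C g) (x y : ℕ) : g (min x C.1) y = g x y := by
  rcases le_total x C.1 with hx | hx
  · rw [min_eq_left hx]
  · rw [min_eq_right hx, h.eq_of_ge_fst y hx]

theorem le_top (h : IsGoodPair X Y C g) (x y : ℕ) : g x y ≤ g C.1 C.2 := by
  rw [← h.eq_min_fst, ← h.swap.eq_min_fst y]
  exact h.mono (min_le_right _ _) (min_le_right _ _)

/-- A point outside `Y` is not the meet of two points of `Y`. -/
theorem not_upFst_or (h : IsGoodPair X Y C g) {x y : ℕ} (hY : (x, y) ∉ Y) :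
    ¬ UpFst Y x y ∨ ¬ UpSnd Y x y := by
  by_contra hc
  push Not at hc
  obtain ⟨⟨b, hb, hb'⟩, a, ha, ha'⟩ := hc
  have := h.inf_right _ hb' _ ha'
  rw [Prod.mk_inf_mk, inf_eq_left.2 ha, inf_eq_right.2 hb] at this
  exact hY this

/-- One of the two unit steps leaving the point has no point of `Y` ahead of it, while `X` contains
the point itself; that step raises `g`. -/
theorem lt_succ_succ (h : IsGoodPair X Y C g) {x y : ℕ} (hX : (x, y) ∈ X) (hY : (x, y) ∉ Y) :
    g x y < g (x + 1) (y + 1) := by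
  rcases h.not_upFst_or hY with h1 | h1
  · have h2 := h.succ_fst_eq_add_one ⟨y, le_rfl, hX⟩ h1
    have h3 := h.mono (le_refl (x + 1)) (Nat.le_add_right y 1)
    omega
  · have h2 : g x (y + 1) = g x y + 1 := h.swap.succ_fst_eq_add_one ⟨x, le_rfl, hX⟩ h1
    have h3 := h.mono (Nat.le_add_right x 1) (le_refl (y + 1))
    omega

/-- The lowest point of `X` on a column above a given height has the same value as the point of
that height. -/
theorem exists_eq_of_upFst (h : IsGoodPair X Y C g) {x y : ℕ} (hX : UpFst X x y) :
    ∃ b, y ≤ b ∧ (x, b) ∈ X ∧ g x b = g x y := by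
  classical
  obtain ⟨hb, hm⟩ := Nat.find_spec hX
  have hmin : ∀ r, y ≤ r → r < Nat.find hX → (x, r) ∉ X := fun r hr hlt hm =>
    Nat.find_min hX hlt ⟨hr, hm⟩
  refine ⟨Nat.find hX, hb, hm, ?_⟩
  have key : ∀ r, y ≤ r → r ≤ Nat.find hX → g x r = g x y := by
    intro r hr
    induction r, hr using Nat.le_induction with
    | base => exact fun _ => rfl
    | succ r hr ih =>
      intro hlt
      rw [← ih (by omega)]
      -- A point of `X` on row `r`, at or to the right of column `x`, would meet the lowest point in
      -- `(x, r)`, which is lower still.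
      refine h.swap.succ_fst_eq_of_not ?_
      rintro ⟨a, ha, ha'⟩
      have := h.inf_left _ hm _ ha'
      change (min x a, min _ r) ∈ X at this
      rw [min_eq_left ha, min_eq_right (by omega)] at this
      exact hmin r hr (by omega) this
  exact key _ hb le_rfl

/-- Beyond a point of value at most `m` there is a point of `X \ Y` of value at most `m`. -/
theorem exists_mem_of_le (h : IsGoodPair X Y C g) {m : ℤ} (hm : m < g C.1 C.2) {x y : ℕ}
    (hxy : g x y ≤ m) : ∃ a b, x ≤ a ∧ y ≤ b ∧ (a, b) ∈ X ∧ (a, b) ∉ Y ∧ g a b ≤ m := by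
  -- Go right along row `y` until the next step exceeds `m`, or until column `C.1`, beyond which `g`
  -- is constant along rows.
  obtain ⟨a, ha, ham, hmax⟩ : ∃ a, min x C.1 ≤ a ∧ g a y ≤ m ∧
      (C.1 ≤ a ∨ m < g (a + 1) y) := by
    by_contra! hc
    have key : ∀ a, min x C.1 ≤ a → g a y ≤ m := by
      intro a ha
      induction a, ha using Nat.le_induction with
      | base => rwa [h.eq_min_fst]
      | succ a ha ih => exact (hc a ha ih).2
    exact absurd (hc C.1 (min_le_right _ _) (key _ (min_le_right _ _))).1 (lt_irrefl _)
  wlog hxa : x ≤ a generalizing a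
  · refine this x (by omega) hxy (.inl (by omega)) le_rfl
  rcases Classical.em (∀ b, y ≤ b → g a b ≤ m) with hall | hex
  · rcases hmax with hmax | hmax
    · have := hall (max y C.2) (le_max_left _ _)
      rw [h.eq_of_ge_fst _ hmax] at this
      have := h.mono (le_refl C.1) (le_max_right y C.2)
      omega
    · have h1 := hall (max y C.2) (le_max_left _ _)
      -- Column `a` stays at most `m` and column `a + 1` exceeds it, so the step between them rises
      -- even at a great height; this yields a point of column `a` in `X \ Y`.
      have h2 := h.mono (le_refl (a + 1)) (le_max_left y C.2)
      rcases h.succ_fst_cases a (max y C.2) with h3 | ⟨-, ⟨b, hb, hbX⟩, hY⟩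
      · omega
      · exact ⟨a, b, hxa, by omega, hbX, fun hbY => hY ⟨b, hb, hbY⟩, hall b (by omega)⟩
  · classical
    push Not at hex
    obtain ⟨hb, hbm⟩ := Nat.find_spec hex
    -- Here `(a, b)` is the last point before the column exceeds `m`, so row `b` meets `X` but not
    -- `Y` from `a` on.
    obtain ⟨b, hbe⟩ : ∃ b, Nat.find hex = b + 1 := Nat.exists_eq_succ_of_ne_zero fun h0 => by
      rw [h0] at hb hbm
      obtain rfl : y = 0 := by omega
      omega
    have hyb : y ≤ b := by
      by_contra hlt
      have : y = b + 1 := by omega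
      rw [hbe, ← this] at hbm
      omega
    have hgb : g a b ≤ m := by
      have := Nat.find_min hex (m := b) (by omega)
      push Not at this
      exact this hyb
    rw [hbe] at hbm
    rcases h.swap.succ_fst_cases b a with h3 | ⟨-, ⟨a', ha', haX⟩, hY⟩
    · change g a (b + 1) = g a b at h3
      omega
    · change (a', b) ∈ X at haX
      have hnY : ∀ a', a ≤ a' → (a', b) ∉ Y := fun a' ha' haY => hY ⟨a', ha', haY⟩
      rcases hmax with hmax | hmax
      · refine ⟨a', b, by omega, hyb, haX, hnY a' ha', ?_⟩
        rwa [h.eq_of_ge_fst b (hmax.trans ha'), ← h.eq_of_ge_fst b hmax]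
      · rcases h.succ_fst_cases a b with h4 | ⟨-, ⟨b', hb', hbX⟩, -⟩
        · have := h.mono (le_refl (a + 1)) hyb
          omega
        · have := h.inf_left _ haX _ hbX
          change (min a' a, min b b') ∈ X at this
          rw [min_eq_right ha', min_eq_left hb'] at this
          exact ⟨a, b, hxa, hyb, this, hnY a le_rfl, hgb⟩

/-! ### Layers as fibres of the value function -/

/-- The part of `X \ Y` where `g` is at most `m`. -/
def sublevel (X Y : Set (ℕ × ℕ)) (g : ℕ → ℕ → ℤ) (m : ℤ) : Set (ℕ × ℕ) :=
  {α | α ∈ X ∧ α ∉ Y ∧ g α.1 α.2 ≤ m}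

theorem mem_maxB (h : IsGoodPair X Y C g) {m : ℤ} {α : ℕ × ℕ} (hX : α ∈ X) (hY : α ∉ Y)
    (hα : g α.1 α.2 = m) : α ∈ maxB (sublevel X Y g m) := by
  refine ⟨⟨hX, hY, hα.le⟩, ?_⟩
  rintro β ⟨-, -, hβ⟩ (rfl | ⟨h1, h2⟩)
  · rfl
  · have h3 := h.lt_succ_succ hX hY
    have h4 := h.mono (Nat.succ_le_of_lt h1) (Nat.succ_le_of_lt h2)
    simp only [Nat.succ_eq_add_one] at h4
    omega

/-- Over a point of `X \ Y` above which there is no point of `Y`, but a point of `X`, a point of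
the next value is found on the same column. -/
theorem exists_succ_of_upFst (h : IsGoodPair X Y C g) {x y : ℕ} (hX : (x, y) ∈ X)
    (hY1 : ¬ UpFst Y x y) (hY2 : ¬ UpSnd Y x y) (hup : UpFst X x (y + 1)) :
    ∃ b, y < b ∧ (x, b) ∈ X ∧ (x, b) ∉ Y ∧ g x b = g x y + 1 := by
  obtain ⟨b, hb, hbX, hgb⟩ := h.exists_eq_of_upFst hup
  refine ⟨b, hb, hbX, fun hbY => hY1 ⟨b, by omega, hbY⟩, ?_⟩
  have : g x (y + 1) = g x y + 1 := h.swap.succ_fst_eq_add_one ⟨x, le_rfl, hX⟩ hY2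
  omega

/-- A maximal point of value below `m` must see `g` rise by two across its unit square, so all four
edges rise. This gives points of value `m` above it and to its right, of which it is the meet, so it
is discarded. A point of value `m` is kept: one of its two outgoing steps rises, so it cannot have
such points on both sides within the sublevel. -/
theorem layer_sublevel (h : IsGoodPair X Y C g) {m : ℤ} (hm : m < g C.1 C.2) :
    layer (sublevel X Y g m) = {α | α ∈ X ∧ α ∉ Y ∧ g α.1 α.2 = m} := by
  ext ⟨x, y⟩
  constructor
  · rintro ⟨⟨⟨hX, hY, hle⟩, hmax⟩, hC⟩
    refine ⟨hX, hY, ?_⟩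
    simp only at hle ⊢
    by_contra hne
    have hgt : m < g (x + 1) (y + 1) := by
      by_contra! hle'
      obtain ⟨a, b, ha, hb, habX, habY, hab⟩ := h.exists_mem_of_le hm hle'
      have := hmax (a, b) ⟨habX, habY, hab⟩ (.inr ⟨ha, hb⟩)
      rw [Prod.ext_iff] at this
      simp only at this
      omega
    have c1 := h.succ_fst_cases x y
    have c2 : g x (y + 1) = g x y ∨ (g x (y + 1) = g x y + 1 ∧ UpSnd X x y ∧ ¬ UpSnd Y x y) :=
      h.swap.succ_fst_cases y x
    have c3 := h.succ_fst_cases x (y + 1)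
    have c4 : g (x + 1) (y + 1) = g (x + 1) y ∨ (g (x + 1) (y + 1) = g (x + 1) y + 1 ∧
      UpSnd X (x + 1) y ∧ ¬ UpSnd Y (x + 1) y) := h.swap.succ_fst_cases y (x + 1)
    obtain ⟨-, -, hY1⟩ := c1.resolve_left (by omega)
    obtain ⟨-, -, hY2⟩ := c2.resolve_left (by omega)
    obtain ⟨-, hX1, -⟩ := c3.resolve_left (by omega)
    obtain ⟨-, hX2, -⟩ := c4.resolve_left (by omega)
    obtain ⟨b, hb, hbX, hbY, hgb⟩ := h.exists_succ_of_upFst hX hY1 hY2 hX1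
    obtain ⟨a, ha, haX, haY, hga⟩ := h.swap.exists_succ_of_upFst (x := y) (y := x) hX hY2 hY1 hX2
    have hgm : g x y + 1 = m := by omega
    refine hC ⟨⟨⟨hX, hY, hle⟩, hmax⟩, (x, b), ⟨h.mem_maxB hbX hbY (hgb.trans hgm), ?_⟩,
      (a, y), ⟨h.mem_maxB haX haY (hga.trans hgm), ?_⟩, ?_⟩
    · simp [hb.ne']
    · simp [ha.ne']
    · rw [Prod.mk_inf_mk, inf_eq_left.2 ha.le, inf_eq_right.2 hb.le]
  · rintro ⟨hX, hY, hg⟩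
    refine ⟨h.mem_maxB hX hY hg, ?_⟩
    have key : ∀ b a, (x, b) ∈ sublevel X Y g m → (a, y) ∈ sublevel X Y g m → y < b → x < a →
        False := by
      rintro b a ⟨-, -, hb⟩ ⟨-, -, ha⟩ hyb hxa
      simp only at hg ha hb
      rcases h.not_upFst_or hY with h1 | h1
      · have h2 := h.succ_fst_eq_add_one ⟨y, le_rfl, hX⟩ h1
        have h3 := h.mono (Nat.succ_le_of_lt hxa) (le_refl y)
        simp only [Nat.succ_eq_add_one] at h3
        omega
      · have h2 : g x (y + 1) = g x y + 1 := h.swap.succ_fst_eq_add_one ⟨x, le_rfl, hX⟩ h1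
        have h3 := h.mono (le_refl x) (Nat.succ_le_of_lt hyb)
        simp only [Nat.succ_eq_add_one] at h3
        omega
    rintro ⟨-, ⟨a, b⟩, ⟨⟨hβ, -⟩, hβne⟩, ⟨a', b'⟩, ⟨⟨hβ', -⟩, hβne'⟩, heq⟩
    simp only [Set.mem_singleton_iff, Prod.mk.injEq, Prod.mk_inf_mk] at hβne hβne' heq
    obtain ⟨h1, h2⟩ := heq
    rcases le_total a a' with hle | hle
    · obtain rfl : x = a := by rw [h1, inf_eq_left.2 hle]
      have hyb : y < b := lt_of_le_of_ne (h2 ▸ inf_le_left) fun he => hβne ⟨rfl, he.symm⟩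
      obtain rfl : y = b' := by omega
      exact key b a' hβ hβ' hyb (lt_of_le_of_ne hle fun he => hβne' ⟨he.symm, rfl⟩)
    · obtain rfl : x = a' := by rw [h1, inf_eq_right.2 hle]
      have hyb : y < b' := lt_of_le_of_ne (h2 ▸ inf_le_right) fun he => hβne' ⟨rfl, he.symm⟩
      obtain rfl : y = b := by omega
      exact key b' a hβ' hβ hyb (lt_of_le_of_ne hle fun he => hβne ⟨he.symm, rfl⟩)

/-! ### Duality of the value function -/

/-- The duality between the columns of `X` and those of `Y`. -/
def IsDualFst (X Y : Set (ℕ × ℕ)) (C : ℕ × ℕ) : Prop :=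
  ∀ x y x' y', x + x' + 1 = C.1 → y + y' = C.2 → (UpFst X x y ↔ ¬ UpFst Y x' y')

/-- By duality the increment at `(x, y)` is `1` minus the indicators of `Y` at the two opposite
places, an expression symmetric in them. -/
theorem add_dual_succ_fst (h : IsGoodPair X Y C g) (hd : IsDualFst X Y C) {x y x' y' : ℕ}
    (hx : x + x' + 1 = C.1) (hy : y + y' = C.2) :
    g (x + 1) y + g x' y' = g x y + g (x' + 1) y' := by
  have h1 := hd x y x' y' hx hy
  have h2 := hd x' y' x y (by omega) (by omega)
  rw [h.succ_fst, h.succ_fst, h1, h2]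
  by_cases p : UpFst Y x y <;> by_cases q : UpFst Y x' y' <;> simp [ind, p, q] <;> ring

theorem add_dual (h : IsGoodPair X Y C g) (hd : IsDualFst X Y C)
    (hd' : IsDualFst (Prod.swap ⁻¹' X) (Prod.swap ⁻¹' Y) C.swap) (x y : ℕ) :
    ∀ x' y', x + x' = C.1 → y + y' = C.2 → g x y + g x' y' = g C.1 C.2 := by
  induction x with
  | succ x ih =>
    intro x' y' hx hy
    rw [h.add_dual_succ_fst hd (by omega) hy]
    exact ih _ _ (by omega) hy
  | zero =>
    induction y with
    | zero =>
      rintro x' y' hx hy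
      rw [h.zero, ← hx, ← hy]
      simp
    | succ y ih =>
      intro x' y' hx hy
      have := h.swap.add_dual_succ_fst hd' (x := y) (y := 0) (x' := y') (y' := x')
        (by simp only [Prod.fst_swap]; omega) (by simp only [Prod.snd_swap]; omega)
      rw [this]
      exact ih _ _ hx (by omega)

/-- The point opposite to column `x'` is on column `x + 1`, not `x`; the extra step costs at most
one. Heights are cut at `C.2` so that the opposite height is a natural number. -/
theorem le_add_of_dual (h : IsGoodPair X Y C g) (hd : IsDualFst X Y C)
    (hd' : IsDualFst (Prod.swap ⁻¹' X) (Prod.swap ⁻¹' Y) C.swap) {x y x' y' : ℕ}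
    (hx : x + x' + 1 = C.1) (hy : C.2 ≤ y + y') : g C.1 C.2 ≤ g x y + g x' y' + 1 := by
  have h1 := h.add_dual hd hd' (x + 1) (min y C.2) x' (C.2 - min y C.2) (by omega) (by omega)
  have h2 := h.mono (le_refl x') (show C.2 - min y C.2 ≤ y' by omega)
  have h3 := h.mono (le_refl (x + 1)) (min_le_left y C.2)
  rcases h.succ_fst_cases x y with h4 | h4 <;> omega

/-- The step right from `(x, y)` misses `Y`, so by duality the opposite column meets `X`; its lowest
point there has the value of the opposite corner. -/
theorem exists_dual_of_not_upFst (h : IsGoodPair X Y C g) (hd : IsDualFst X Y C)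
    (hd' : IsDualFst (Prod.swap ⁻¹' X) (Prod.swap ⁻¹' Y) C.swap) {x y : ℕ} (hX : (x, y) ∈ X)
    (hY : ¬ UpFst Y x y) : ∃ x' y', x + x' + 1 = C.1 ∧ C.2 ≤ y + y' ∧ (x', y') ∈ X ∧
      g x y + g x' y' + 1 = g C.1 C.2 := by
  have hx : x < C.1 := by
    by_contra! hx
    exact hY ⟨max y C.2, le_max_left _ _, h.full _ _ hx (le_max_right _ _)⟩
  have hstep := h.succ_fst_eq_add_one ⟨y, le_rfl, hX⟩ hY
  have hm : ∀ z, g z (min y C.2) = g z y := fun z => h.swap.eq_min_fst y z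
  have hY' : ¬ UpFst Y x (min y C.2) := by
    intro hc
    have := h.succ_fst_eq_of_mem hc
    rw [hm, hm] at this
    omega
  obtain ⟨b, hb, hbX, hgb⟩ := h.exists_eq_of_upFst
    ((hd (C.1 - 1 - x) (C.2 - min y C.2) x (min y C.2) (by omega) (by omega)).2 hY')
  have := h.add_dual hd hd' (x + 1) (min y C.2) (C.1 - 1 - x) (C.2 - min y C.2)
    (by omega) (by omega)
  rw [hm] at this
  exact ⟨C.1 - 1 - x, b, by omega, by omega, hbX, by omega⟩

end IsGoodPair

/-! ### Symmetric sets and translates -/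

/-- `β` lies in `Δ₁(c - (1, 1) - α)`. -/
def DualFst (c : ℕ × ℕ) (α β : ℕ × ℕ) : Prop := α.1 + β.1 + 1 = c.1 ∧ c.2 ≤ α.2 + β.2

/-- `β` lies in `Δ₂(c - (1, 1) - α)`. -/
def DualSnd (c : ℕ × ℕ) (α β : ℕ × ℕ) : Prop := α.2 + β.2 + 1 = c.2 ∧ c.1 ≤ α.1 + β.1

/-- Symmetry for a subset of `ℕ²`. -/
def IsSymmSet (X : Set (ℕ × ℕ)) (c : ℕ × ℕ) : Prop :=
  ∀ α, α ∈ X ↔ ∀ β ∈ X, ¬ DualFst c α β ∧ ¬ DualSnd c α β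

theorem IsSymmSet.swap {X : Set (ℕ × ℕ)} {c : ℕ × ℕ} (h : IsSymmSet X c) :
    IsSymmSet (Prod.swap ⁻¹' X) c.swap := by
  intro α
  rw [Set.mem_preimage, h]
  exact ⟨fun H β hβ => (H β.swap hβ).symm, fun H β hβ => (H β.swap hβ).symm⟩

/-- For the converse, suppose column `x` is empty from `y` on. Far up, failure of membership puts a
point of `X` on the opposite column, whose height is bounded by assumption. Applying symmetry
opposite to its highest point gives a higher one, or one to the right and then, by balancedness,
again a higher one. -/
theorem IsSymmSet.upFst_iff {X : Set (ℕ × ℕ)} {c : ℕ × ℕ} (h : IsSymmSet X c)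
    (hX : IsBalanced X) (hfull : ∀ x y, c.1 ≤ x → c.2 ≤ y → (x, y) ∈ X) (x y : ℕ) :
    UpFst X x y ↔ ∀ β ∈ X, ¬ DualFst c (x, y) β := by
  constructor
  · rintro ⟨b, hb, hm⟩ β hβ ⟨h1, h2⟩
    exact ((h _).1 hm β hβ).1 ⟨h1, by simp only at h2 ⊢; omega⟩
  · intro H
    by_contra hn
    have hnot : ∀ b, y ≤ b → (x, b) ∉ X := fun b hb hm => hn ⟨b, hb, hm⟩
    have hxc : x < c.1 := by
      by_contra! hx
      exact hnot _ (le_max_left y c.2) (hfull _ _ hx (le_max_right y c.2))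
    have ex : ∀ b, y ≤ b → ∃ β ∈ X, DualFst c (x, b) β ∨ DualSnd c (x, b) β := by
      intro b hb
      have := mt (h (x, b)).2 (hnot b hb)
      push Not at this
      obtain ⟨β, hβ, hd⟩ := this
      exact ⟨β, hβ, or_iff_not_imp_left.2 hd⟩
    classical
    have hbd : ∀ b, (c.1 - 1 - x, b) ∈ X → b + y + 1 ≤ c.2 := by
      intro b hb
      by_contra hlt
      exact H _ hb ⟨by simp only; omega, by simp only; omega⟩
    obtain ⟨⟨a, b⟩, hβ, hd | hd⟩ := ex (max y c.2) (le_max_left _ _)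
    · obtain rfl : a = c.1 - 1 - x := by have := hd.1; simp only at this; omega
      obtain ⟨b, hb, hmax⟩ : ∃ b, (c.1 - 1 - x, b) ∈ X ∧
          ∀ b', (c.1 - 1 - x, b') ∈ X → b' ≤ b := by
        have hle : b ≤ c.2 := by have := hbd b hβ; omega
        exact ⟨_, Nat.findGreatest_spec (P := fun b => (c.1 - 1 - x, b) ∈ X) hle hβ,
          fun b' hb' => Nat.le_findGreatest (by have := hbd b' hb'; omega) hb'⟩
      have hb' := hbd b hb
      obtain ⟨⟨a', b'⟩, hβ', hd | hd⟩ := ex (c.2 - 1 - b) (by omega)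
      · obtain ⟨h1, h2⟩ := hd
        simp only at h1 h2
        obtain rfl : a' = c.1 - 1 - x := by omega
        have := hmax b' hβ'
        omega
      · obtain ⟨h1, h2⟩ := hd
        simp only at h1 h2
        obtain rfl : b' = b := by omega
        obtain ⟨b'', hb'', hm⟩ := (hX _ _ hb).2 ⟨a', by omega, hβ'⟩
        have := hmax b'' hm
        omega
    · have := hd.1
      simp only at this
      omega

/-- The translate of `X` by `t`. -/
def translate (X : Set (ℕ × ℕ)) (t : ℕ × ℕ) : Set (ℕ × ℕ) := {α | ∃ σ ∈ X, σ + t = α}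

theorem translate_swap (X : Set (ℕ × ℕ)) (t : ℕ × ℕ) :
    Prod.swap ⁻¹' translate X t = translate (Prod.swap ⁻¹' X) t.swap := by
  ext α
  constructor
  · rintro ⟨σ, hσ, h⟩
    exact ⟨σ.swap, hσ, by rw [← Prod.swap_add, h, Prod.swap_swap]⟩
  · rintro ⟨σ, hσ, h⟩
    exact ⟨σ.swap, hσ, by rw [← h, Prod.swap_add, Prod.swap_swap]⟩

theorem IsSymmSet.isDualFst {X : Set (ℕ × ℕ)} {c : ℕ × ℕ} (h : IsSymmSet X c)
    (hX : IsBalanced X) (hfull : ∀ x y, c.1 ≤ x → c.2 ≤ y → (x, y) ∈ X) (t : ℕ × ℕ) :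
    IsGoodPair.IsDualFst X (translate X t) (c + t) := by
  intro x y x' y' hx hy
  rw [Prod.fst_add] at hx
  rw [Prod.snd_add] at hy
  rw [h.upFst_iff hX hfull]
  constructor
  · rintro H ⟨b, hb, σ, hσ, he⟩
    rw [Prod.ext_iff] at he
    simp only [Prod.fst_add, Prod.snd_add] at he
    exact H σ hσ ⟨by simp only; omega, by simp only; omega⟩
  · rintro H β hβ ⟨h1, h2⟩
    simp only at h1 h2
    exact H ⟨β.2 + t.2, by omega, β, hβ, Prod.ext (by simp only [Prod.fst_add]; omega) rfl⟩

theorem upFst_translate {X : Set (ℕ × ℕ)} {t : ℕ × ℕ} (x y : ℕ) :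
    UpFst (translate X t) (x + t.1) (y + t.2) ↔ UpFst X x y := by
  constructor
  · rintro ⟨b, hb, σ, hσ, he⟩
    rw [Prod.ext_iff] at he
    simp only [Prod.fst_add, Prod.snd_add] at he
    refine ⟨σ.2, by omega, ?_⟩
    rwa [show x = σ.1 by omega]
  · rintro ⟨b, hb, hm⟩
    exact ⟨b + t.2, by omega, _, hm, rfl⟩

theorem upSnd_translate {X : Set (ℕ × ℕ)} {t : ℕ × ℕ} (x y : ℕ) :
    UpSnd (translate X t) (x + t.1) (y + t.2) ↔ UpSnd X x y := by
  constructor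
  · rintro ⟨b, hb, σ, hσ, he⟩
    rw [Prod.ext_iff] at he
    simp only [Prod.fst_add, Prod.snd_add] at he
    refine ⟨σ.1, by omega, ?_⟩
    rwa [show y = σ.2 by omega]
  · rintro ⟨b, hb, hm⟩
    exact ⟨b + t.1, by omega, _, hm, rfl⟩

theorem count_translate {X : Set (ℕ × ℕ)} {t : ℕ × ℕ} (hX : IsBalanced (translate X t))
    (hX' : IsBalanced X) (x y : ℕ) :
    count (translate X t) (x + t.1) (y + t.2) = count X x y := by
  have hge : ∀ a b, (a, b) ∈ translate X t → t.1 ≤ a ∧ t.2 ≤ b := by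
    rintro a b ⟨σ, -, he⟩
    rw [Prod.ext_iff] at he
    simp only [Prod.fst_add, Prod.snd_add] at he
    omega
  induction x with
  | succ x ih =>
    rw [Nat.add_right_comm, count_succ_fst hX, count_succ_fst hX', ih, upFst_translate]
  | zero =>
    induction y with
    | succ y ih => rw [Nat.add_right_comm, count_succ_snd, count_succ_snd, ih, upSnd_translate]
    | zero =>
      have h1 : ∑ i ∈ Finset.range (0 + t.1), ind (UpFst (translate X t) i 0) = 0 := by
        refine Finset.sum_eq_zero fun i hi => ind_false ?_
        rintro ⟨b, -, hm⟩
        have := hge _ _ hm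
        rw [Finset.mem_range] at hi
        omega
      have h2 : ∑ j ∈ Finset.range (0 + t.2), ind (UpSnd (translate X t) (0 + t.1) j) = 0 := by
        refine Finset.sum_eq_zero fun i hi => ind_false ?_
        rintro ⟨b, -, hm⟩
        have := hge _ _ hm
        rw [Finset.mem_range] at hi
        omega
      rw [count, count, h1, h2]
      simp

theorem count_add_of_full {X : Set (ℕ × ℕ)} {c : ℕ × ℕ} (hX : IsBalanced X)
    (hfull : ∀ x y, c.1 ≤ x → c.2 ≤ y → (x, y) ∈ X) (a b : ℕ) :
    count X (c.1 + a) (c.2 + b) = count X c.1 c.2 + a + b := by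
  induction a with
  | succ a ih =>
    rw [← Nat.add_assoc, count_succ_fst hX, ih,
      ind_true ⟨_, le_rfl, hfull _ _ (by omega) (by omega)⟩]
    push_cast
    ring
  | zero =>
    induction b with
    | succ b ih =>
      rw [← Nat.add_assoc, count_succ_snd, ih,
        ind_true ⟨_, le_rfl, hfull _ _ (by omega) (by omega)⟩]
      push_cast
      ring
    | zero => simp

theorem IsBalanced.translate {X : Set (ℕ × ℕ)} (hX : IsBalanced X) (t : ℕ × ℕ) :
    IsBalanced (translate X t) := by
  rintro _ _ ⟨σ, hσ, he⟩
  obtain ⟨rfl, rfl⟩ := Prod.ext_iff.1 he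
  simp only [Prod.fst_add, Prod.snd_add]
  rw [Nat.add_right_comm, upFst_translate, Nat.add_right_comm σ.1, upSnd_translate]
  exact hX _ _ hσ

/-! ### Levels of the Apéry set of a good semigroup -/

namespace IsGood

variable {S : AddSubmonoid (ℕ × ℕ)}

/-- In (G2) the two points differ in the other coordinate, which forces the new point onto the row
or column of the lesser one. -/
theorem isBalanced (hS : IsGood S) : IsBalanced (S : Set (ℕ × ℕ)) := by
  intro x y hxy
  constructor
  · rintro ⟨b, hb, hm⟩
    obtain ⟨δ, hδ, h1, -, h2⟩ := hS.exists_fst _ hxy _ hm rfl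
    simp only at h1 h2
    have h3 : δ.2 = y := (h2 (by omega)).trans (by omega)
    exact ⟨δ.1, h1, by rw [← h3]; exact hδ⟩
  · rintro ⟨a, ha, hm⟩
    obtain ⟨δ, hδ, h1, -, h2⟩ := hS.exists_snd _ hxy _ hm rfl
    simp only at h1 h2
    have h3 : δ.1 = x := (h2 (by omega)).trans (by omega)
    exact ⟨δ.2, h1, by rw [← h3]; exact hδ⟩

theorem mem_of_conductor_le (hS : IsGood S) {α : ℕ × ℕ} (h : conductor S ≤ α) : α ∈ S :=
  mem_condSet_iff.1 hS.isLeast_conductor.1 α h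

theorem full (hS : IsGood S) (x y : ℕ) (hx : (conductor S).1 ≤ x) (hy : (conductor S).2 ≤ y) :
    (x, y) ∈ (S : Set (ℕ × ℕ)) :=
  hS.mem_of_conductor_le ⟨hx, hy⟩

/-- The value function on the grid whose fibres are the levels of the Apéry set. -/
noncomputable def value (S : AddSubmonoid (ℕ × ℕ)) (x y : ℕ) : ℤ :=
  count (S : Set (ℕ × ℕ)) x y - count (translate (S : Set (ℕ × ℕ)) (minElt S)) x y

theorem isGoodPair (hS : IsGood S) : IsGoodPair (S : Set (ℕ × ℕ))
    (translate (S : Set (ℕ × ℕ)) (minElt S)) (conductor S + minElt S) (value S) where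
  subset := by
    rintro _ ⟨σ, hσ, rfl⟩
    exact S.add_mem hσ hS.isLeast_minElt.1.1
  inf_left := hS.inf_mem
  inf_right := by
    rintro _ ⟨σ, hσ, rfl⟩ _ ⟨τ, hτ, rfl⟩
    refine ⟨σ ⊓ τ, hS.inf_mem _ hσ _ hτ, Prod.ext ?_ ?_⟩
    · exact min_add _ _ _
    · exact min_add _ _ _
  balanced := hS.isBalanced
  full := by
    intro x y hx hy
    rw [Prod.fst_add] at hx
    rw [Prod.snd_add] at hy
    refine ⟨(x - (minElt S).1, y - (minElt S).2), hS.full _ _ (by omega) (by omega),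
      Prod.ext ?_ ?_⟩
    · simp only [Prod.fst_add]; omega
    · simp only [Prod.snd_add]; omega
  zero := by simp [value, count]
  succ_fst := by
    intro x y
    rw [value, value, count_succ_fst hS.isBalanced, count_succ_fst (hS.isBalanced.translate _)]
    ring
  succ_snd := by
    intro x y
    rw [value, value, count_succ_snd, count_succ_snd]
    ring

/-- At `c + e` the translate counts what `S` counts at `c`, and each of the `e₁ + e₂` steps from `c`
to `c + e` counts for `S`. -/
theorem value_top (hS : IsGood S) :
    value S (conductor S + minElt S).1 (conductor S + minElt S).2 = mult S := by
  rw [value, Prod.fst_add, Prod.snd_add, count_add_of_full hS.isBalanced hS.full,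
    count_translate (hS.isBalanced.translate _) hS.isBalanced, mult]
  push_cast
  ring

theorem value_nonneg (hS : IsGood S) (x y : ℕ) : 0 ≤ value S x y :=
  hS.isGoodPair.zero ▸ hS.isGoodPair.mono (Nat.zero_le x) (Nat.zero_le y)

theorem value_lt (hS : IsGood S) {α : ℕ × ℕ} (hα : α ∈ Ap S) : value S α.1 α.2 < mult S := by
  rw [← hS.value_top]
  exact (hS.isGoodPair.lt_succ_succ hα.1 hα.2).trans_le (hS.isGoodPair.le_top _ _)

theorem layer_eq (hS : IsGood S) {k : ℕ} (h : remaining S k =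
    IsGoodPair.sublevel S (translate (S : Set (ℕ × ℕ)) (minElt S)) (value S) (mult S - k - 1)) :
    apLayer S k = {α | α ∈ Ap S ∧ value S α.1 α.2 = mult S - k - 1} := by
  rw [apLayer, h, hS.isGoodPair.layer_sublevel (by rw [hS.value_top]; omega)]
  ext α
  exact and_assoc.symm

theorem remaining_eq_sublevel (hS : IsGood S) {k : ℕ} (hk : k ≤ mult S) : remaining S k =
    IsGoodPair.sublevel S (translate (S : Set (ℕ × ℕ)) (minElt S)) (value S)
      (mult S - k - 1) := by
  induction k with
  | zero =>
    ext α
    constructor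
    · intro hα
      have := hS.value_lt hα
      exact ⟨hα.1, hα.2, by push_cast; omega⟩
    · exact fun hα => ⟨hα.1, hα.2.1⟩
  | succ k ih =>
    have hrem := ih (by omega)
    have hlay := hS.layer_eq hrem
    change remaining S k \ apLayer S k = _
    rw [hlay, hrem]
    ext α
    constructor
    · rintro ⟨⟨h1, h2, h3⟩, h4⟩
      have h5 : value S α.1 α.2 ≠ mult S - k - 1 := fun h5 => h4 ⟨⟨h1, h2⟩, h5⟩
      exact ⟨h1, h2, by push_cast; omega⟩
    · rintro ⟨h1, h2, h3⟩
      push_cast at h3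
      exact ⟨⟨h1, h2, by omega⟩, fun h4 => by have := h4.2; omega⟩

theorem minElt_pos (hS : IsGood S) : 0 < (minElt S).1 ∧ 0 < (minElt S).2 := by
  have h := hS.isLeast_minElt.1
  have := mt (hS.isLocal _ h.1) h.2
  omega

theorem zero_mem_Ap (hS : IsGood S) : (0 : ℕ × ℕ) ∈ Ap S := by
  refine ⟨S.zero_mem, ?_⟩
  rintro ⟨σ, -, he⟩
  have := congrArg Prod.fst he
  simp only [Prod.fst_add, Prod.fst_zero] at this
  have := hS.minElt_pos
  omega

/-- After `mult S` removals only negative values could remain; before that, `0`, of value `0`, is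
still there. -/
theorem numLevels_eq (hS : IsGood S) : numLevels S = mult S := by
  have hmem : mult S ∈ {N : ℕ | Ap S = ⋃ k < N, apLayer S k} := by
    refine Set.Subset.antisymm (fun α hα => ?_) ?_
    · by_contra hn
      have : α ∈ remaining S (mult S) := by
        rw [remaining_eq]
        exact ⟨hα, hn⟩
      rw [hS.remaining_eq_sublevel le_rfl] at this
      have h1 := this.2.2
      have h2 := hS.value_nonneg α.1 α.2
      omega
    · refine Set.iUnion₂_subset fun k _ α hα => ?_
      have : α ∈ remaining S k := hα.1.1
      rw [remaining_eq] at this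
      exact this.1
  refine le_antisymm (Nat.sInf_le hmem) (le_csInf ⟨_, hmem⟩ fun N hN => ?_)
  by_contra! hlt
  have h0 : (0 : ℕ × ℕ) ∈ remaining S N := by
    rw [hS.remaining_eq_sublevel hlt.le]
    refine ⟨hS.zero_mem_Ap.1, hS.zero_mem_Ap.2, ?_⟩
    have : value S (0 : ℕ × ℕ).1 (0 : ℕ × ℕ).2 = 0 := hS.isGoodPair.zero
    omega
  rw [remaining_eq, ← show Ap S = ⋃ k < N, apLayer S k from hN] at h0
  exact h0.2 h0.1

/-- The levels of the Apéry set are the fibres of the value function. -/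
theorem mem_level_iff (hS : IsGood S) {i : ℕ} {α : ℕ × ℕ} :
    α ∈ level S i ↔ α ∈ Ap S ∧ value S α.1 α.2 + 1 = i := by
  have key : ∀ k < mult S, apLayer S k = {α | α ∈ Ap S ∧ value S α.1 α.2 = mult S - k - 1} :=
    fun k hk => hS.layer_eq (hS.remaining_eq_sublevel hk.le)
  constructor
  · rintro ⟨h1, h2, h3⟩
    rw [hS.numLevels_eq] at h2 h3
    rw [key _ (by omega)] at h3
    have := h3.2
    exact ⟨h3.1, by omega⟩
  · rintro ⟨h1, h2⟩
    have h3 := hS.value_lt h1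
    have h4 := hS.value_nonneg α.1 α.2
    refine ⟨by omega, by rw [hS.numLevels_eq]; omega, ?_⟩
    rw [hS.numLevels_eq, key _ (by omega)]
    exact ⟨h1, by omega⟩

/-! ### Symmetry implies label duality -/

theorem mem_DeltaS_gam_iff {α β : ℕ × ℕ} : β ∈ DeltaS S (gam S - toZ α) ↔
    β ∈ S ∧ (DualFst (conductor S) α β ∨ DualSnd (conductor S) α β) := by
  simp only [DeltaS, Delta, Delta₁, Delta₂, gam, toZ, DualFst, DualSnd, Set.mem_ofPred_eq,
    Set.mem_union, Prod.fst_sub, Prod.snd_sub]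
  refine and_congr_right fun _ => or_congr (and_congr ?_ ?_) (and_congr ?_ ?_) <;> omega

theorem mem_DeltaS_dual_iff {α β : ℕ × ℕ} : β ∈ DeltaS S (dual S α) ↔
    β ∈ S ∧ (DualFst (conductor S + minElt S) α β ∨ DualSnd (conductor S + minElt S) α β) := by
  simp only [DeltaS, Delta, Delta₁, Delta₂, gam, dual, toZ, DualFst, DualSnd, Set.mem_ofPred_eq,
    Set.mem_union, Prod.fst_sub, Prod.snd_sub, Prod.fst_add, Prod.snd_add]
  refine and_congr_right fun _ => or_congr (and_congr ?_ ?_) (and_congr ?_ ?_) <;> omega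

theorem mem_dualLevel_iff (hS : IsGood S) {i : ℕ} {β : ℕ × ℕ} : β ∈ dualLevel S i ↔
    (∃ ω ∈ Ap S, value S ω.1 ω.2 + 1 = i ∧ β ∈ DeltaS S (dual S ω)) ∧
      ∀ ω ∈ Ap S, value S ω.1 ω.2 + 1 < i → β ∉ DeltaS S (dual S ω) := by
  simp only [dualLevel, Set.mem_sdiff, Set.mem_iUnion, exists_prop, not_exists, not_and,
    hS.mem_level_iff]
  refine and_congr (exists_congr fun ω => by tauto)
    ⟨fun H ω hω hlt => ?_, fun H j hj ω hω => H ω hω.1 (by omega)⟩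
  have := hS.value_nonneg ω.1 ω.2
  exact H (value S ω.1 ω.2 + 1).toNat (by omega) ω ⟨hω, by omega⟩

theorem isSymmetric_iff : IsSymmetric S ↔ IsSymmSet (S : Set (ℕ × ℕ)) (conductor S) := by
  refine forall_congr' fun α => iff_congr Iff.rfl ?_
  simp only [Set.eq_empty_iff_forall_notMem, mem_DeltaS_gam_iff, not_and, not_or]
  rfl

/-- If `β = σ + e` with `σ ∈ S`, then `σ` lies in `Δ^S(γ - ω)`, which symmetry makes empty. -/
theorem dual_mem_Ap (hsym : IsSymmetric S) {ω β : ℕ × ℕ} (hω : ω ∈ S)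
    (hβ : β ∈ DeltaS S (dual S ω)) : β ∈ Ap S := by
  rw [mem_DeltaS_dual_iff] at hβ
  refine ⟨hβ.1, ?_⟩
  rintro ⟨σ, hσ, rfl⟩
  have := (isSymmetric_iff.1 hsym ω).1 hω σ hσ
  have h2 := hβ.2
  simp only [DualFst, DualSnd, Prod.fst_add, Prod.snd_add] at this h2
  omega

theorem isDualFst (hS : IsGood S) (hsym : IsSymmetric S) : IsGoodPair.IsDualFst
    (S : Set (ℕ × ℕ)) (translate (S : Set (ℕ × ℕ)) (minElt S)) (conductor S + minElt S) :=
  (isSymmetric_iff.1 hsym).isDualFst hS.isBalanced hS.full _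

theorem isDualFst_swap (hS : IsGood S) (hsym : IsSymmetric S) : IsGoodPair.IsDualFst
    (Prod.swap ⁻¹' (S : Set (ℕ × ℕ)))
    (Prod.swap ⁻¹' translate (S : Set (ℕ × ℕ)) (minElt S)) (conductor S + minElt S).swap := by
  rw [translate_swap, Prod.swap_add]
  exact (isSymmetric_iff.1 hsym).swap.isDualFst hS.isGoodPair.swap.balanced
    (fun x y hx hy => hS.full y x hy hx) _

theorem mult_le_value_add (hS : IsGood S) (hsym : IsSymmetric S) {ω β : ℕ × ℕ}
    (hβ : β ∈ DeltaS S (dual S ω)) : mult S ≤ value S ω.1 ω.2 + value S β.1 β.2 + 1 := by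
  rw [mem_DeltaS_dual_iff] at hβ
  rw [← hS.value_top]
  obtain ⟨-, ⟨h1, h2⟩ | ⟨h1, h2⟩⟩ := hβ
  · exact hS.isGoodPair.le_add_of_dual (hS.isDualFst hsym) (hS.isDualFst_swap hsym) h1 h2
  · exact hS.isGoodPair.swap.le_add_of_dual (hS.isDualFst_swap hsym) (hS.isDualFst hsym) h1 h2

theorem exists_dual (hS : IsGood S) (hsym : IsSymmetric S) {β : ℕ × ℕ} (hβ : β ∈ Ap S) :
    ∃ ω ∈ Ap S, β ∈ DeltaS S (dual S ω) ∧
      value S ω.1 ω.2 + value S β.1 β.2 + 1 = mult S := by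
  suffices H : ∃ ω ∈ S, (DualFst (conductor S + minElt S) β ω ∨
      DualSnd (conductor S + minElt S) β ω) ∧
      value S β.1 β.2 + value S ω.1 ω.2 + 1 = mult S by
    obtain ⟨ω, hω, hd, hv⟩ := H
    refine ⟨ω, dual_mem_Ap hsym hβ.1 (mem_DeltaS_dual_iff.2 ⟨hω, hd⟩),
      mem_DeltaS_dual_iff.2 ⟨hβ.1, ?_⟩, by omega⟩
    simp only [DualFst, DualSnd] at hd ⊢
    omega
  rw [← hS.value_top]
  rcases hS.isGoodPair.not_upFst_or hβ.2 with h | h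
  · obtain ⟨x, y, h1, h2, h3, h4⟩ := hS.isGoodPair.exists_dual_of_not_upFst
      (hS.isDualFst hsym) (hS.isDualFst_swap hsym) hβ.1 h
    exact ⟨(x, y), h3, .inl ⟨h1, h2⟩, h4⟩
  · obtain ⟨x, y, h1, h2, h3, h4⟩ := hS.isGoodPair.swap.exists_dual_of_not_upFst
      (hS.isDualFst_swap hsym) (hS.isDualFst hsym) (x := β.2) (y := β.1) hβ.1 h
    exact ⟨(y, x), h3, .inr ⟨h1, h2⟩, h4⟩

/-- The least value of an Apéry element `ω` with `β ∈ Δ^S(ω')` is `mult S - 1` minus the value of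
`β`. -/
theorem dualLevel_eq (hS : IsGood S) (hsym : IsSymmetric S) {i : ℕ} (hi : i ≤ mult S) :
    dualLevel S i = level S (mult S - i + 1) := by
  ext β
  rw [hS.mem_dualLevel_iff, hS.mem_level_iff]
  constructor
  · rintro ⟨⟨ω, hω, hv, hβ⟩, hmin⟩
    have hβA := dual_mem_Ap hsym hω.1 hβ
    refine ⟨hβA, ?_⟩
    have h1 := hS.mult_le_value_add hsym hβ
    obtain ⟨ω', hω', hβ', hv'⟩ := hS.exists_dual hsym hβA
    have h2 : ¬ value S ω'.1 ω'.2 + 1 < i := fun hlt => hmin ω' hω' hlt hβ'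
    omega
  · rintro ⟨hβ, hv⟩
    obtain ⟨ω, hω, hβω, hv'⟩ := hS.exists_dual hsym hβ
    refine ⟨⟨ω, hω, by omega, hβω⟩, fun ω' _ hlt hβ' => ?_⟩
    have := hS.mult_le_value_add hsym hβ'
    omega

/-! ### Label duality implies symmetry -/

/-- A column left of the conductor contains no high point, as the conductor is minimal. -/
theorem not_mem_of_succ_eq (hS : IsGood S) {a b : ℕ} (ha : a + 1 = (conductor S).1)
    (hb : (conductor S).2 ≤ b) : (a, b) ∉ S := by
  intro hab
  -- Points of column `a + 1` lie to the right of each point found, so balancedness always gives a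
  -- higher one.
  have hhigh : ∀ n, ∃ b', n ≤ b' ∧ (a, b') ∈ S := by
    intro n
    induction n with
    | zero => exact ⟨b, Nat.zero_le _, hab⟩
    | succ n ih =>
      obtain ⟨b', hb', hm⟩ := ih
      have hm' : (a, max b b') ∈ S := by
        rcases le_total b b' with h | h
        · rwa [max_eq_right h]
        · rwa [max_eq_left h]
      obtain ⟨b'', h1, h2⟩ := (hS.isBalanced _ _ hm').2
        ⟨a + 1, le_rfl, hS.full _ _ ha.ge (hb.trans (le_max_left _ _))⟩
      exact ⟨b'', by omega, h2⟩
  -- Meets with column `a + 1` now fill column `a` from the conductor's height up, contradicting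
  -- minimality.
  have hmem : (a, (conductor S).2) ∈ condSet S := by
    rw [mem_condSet_iff]
    rintro ⟨x, y⟩ ⟨hx, hy⟩
    simp only at hx hy
    rcases hx.eq_or_lt with rfl | hx
    · obtain ⟨b', hb', hm⟩ := hhigh y
      have := hS.inf_mem _ hm _ (hS.full (a + 1) y ha.ge hy)
      rwa [Prod.mk_inf_mk, inf_eq_left.2 (Nat.le_succ a), inf_eq_right.2 hb'] at this
    · exact hS.full _ _ (by omega) hy
  have := (hS.isLeast_conductor.2 hmem).1
  simp only at this
  omega

theorem not_mem_of_succ_eq' (hS : IsGood S) {a b : ℕ} (hb : b + 1 = (conductor S).2)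
    (ha : (conductor S).1 ≤ a) : (a, b) ∉ S := by
  intro hab
  have hhigh : ∀ n, ∃ a', n ≤ a' ∧ (a', b) ∈ S := by
    intro n
    induction n with
    | zero => exact ⟨a, Nat.zero_le _, hab⟩
    | succ n ih =>
      obtain ⟨a', ha', hm⟩ := ih
      have hm' : (max a a', b) ∈ S := by
        rcases le_total a a' with h | h
        · rwa [max_eq_right h]
        · rwa [max_eq_left h]
      obtain ⟨a'', h1, h2⟩ := (hS.isBalanced _ _ hm').1
        ⟨b + 1, le_rfl, hS.full _ _ (ha.trans (le_max_left _ _)) hb.ge⟩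
      exact ⟨a'', by omega, h2⟩
  have hmem : ((conductor S).1, b) ∈ condSet S := by
    rw [mem_condSet_iff]
    rintro ⟨x, y⟩ ⟨hx, hy⟩
    simp only at hx hy
    rcases hy.eq_or_lt with rfl | hy
    · obtain ⟨a', ha', hm⟩ := hhigh x
      have := hS.inf_mem _ hm _ (hS.full x (b + 1) hx hb.ge)
      rwa [Prod.mk_inf_mk, inf_eq_right.2 ha', inf_eq_left.2 (Nat.le_succ b)] at this
    · exact hS.full _ _ hx (by omega)
  have := (hS.isLeast_conductor.2 hmem).2
  simp only at this
  omega

/-- If every element of the Apéry set has a nonempty dual set, then `S` is symmetric. -/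
theorem isSymmetric_of_forall_dual (hS : IsGood S)
    (H : ∀ β ∈ Ap S, ∃ ω ∈ S, β ∈ DeltaS S (dual S ω)) : IsSymmetric S := by
  rw [isSymmetric_iff]
  intro α
  constructor
  · intro hα β hβ
    have hm := S.add_mem hα hβ
    exact ⟨fun h => hS.not_mem_of_succ_eq h.1 h.2 hm, fun h => hS.not_mem_of_succ_eq' h.1 h.2 hm⟩
  · intro hα
    by_contra hn
    -- The least such multiple brings `α` into the Apéry set.
    have hex : ∃ k : ℕ, α + k • minElt S ∈ S := by
      refine ⟨(conductor S).1 + (conductor S).2, hS.mem_of_conductor_le ⟨?_, ?_⟩⟩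
      · have := Nat.le_mul_of_pos_right ((conductor S).1 + (conductor S).2) hS.minElt_pos.1
        simp only [Prod.fst_add, Prod.smul_fst, smul_eq_mul]
        omega
      · have := Nat.le_mul_of_pos_right ((conductor S).1 + (conductor S).2) hS.minElt_pos.2
        simp only [Prod.snd_add, Prod.smul_snd, smul_eq_mul]
        omega
    classical
    have hk := Nat.find_spec hex
    obtain ⟨k, hke⟩ : ∃ k, Nat.find hex = k + 1 := Nat.exists_eq_succ_of_ne_zero fun h0 => by
      rw [h0, zero_smul, add_zero] at hk
      exact hn hk
    have hmin : α + k • minElt S ∉ S := Nat.find_min hex (by omega)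
    rw [hke, succ_nsmul, ← add_assoc] at hk
    obtain ⟨ω, hω, hβ⟩ := H (α + k • minElt S + minElt S) ⟨hk, by
      rintro ⟨σ, hσ, he⟩
      exact hmin (add_right_cancel he ▸ hσ)⟩
    rw [mem_DeltaS_dual_iff] at hβ
    -- Since `α + (k + 1)e` lies in `Δ(γ + e - ω)`, the element `ω + ke` of `S` lies in `Δ(γ - α)`.
    have := hα _ (S.add_mem hω (S.nsmul_mem hS.isLeast_minElt.1.1 k))
    have h2 := hβ.2
    simp only [DualFst, DualSnd, Prod.fst_add, Prod.snd_add] at this h2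
    omega

end IsGood

end GoodSemigroup

theorem theorem5p3 (S : AddSubmonoid (ℕ × ℕ)) (hS : GoodSemigroup.IsGood S) :
    GoodSemigroup.IsSymmetric S ↔
      ∀ i : ℕ, 1 ≤ i → i ≤ GoodSemigroup.mult S →
        GoodSemigroup.dualLevel S i =
          GoodSemigroup.level S (GoodSemigroup.mult S - i + 1) := by
  refine ⟨fun hsym i _ hi => hS.dualLevel_eq hsym hi, fun H => ?_⟩
  refine hS.isSymmetric_of_forall_dual fun β hβ => ?_
  have h1 := hS.value_lt hβ
  have h2 := hS.value_nonneg β.1 β.2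
  -- The index is chosen so that the level on the right-hand side is the one containing `β`.
  have hi := H (GoodSemigroup.mult S - (GoodSemigroup.IsGood.value S β.1 β.2).toNat)
    (by omega) (by omega)
  have hβ' : β ∈ GoodSemigroup.level S (GoodSemigroup.mult S -
      (GoodSemigroup.mult S - (GoodSemigroup.IsGood.value S β.1 β.2).toNat) + 1) :=
    hS.mem_level_iff.2 ⟨hβ, by omega⟩
  rw [← hi, hS.mem_dualLevel_iff] at hβ'
  obtain ⟨⟨ω, hω, -, hd⟩, -⟩ := hβ'
  exact ⟨ω, hω.1, hd⟩
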